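/- Let $p$ be a prime and let $F$ be a field containing a primitive $p$th root of unity $\xi_p$. Fix a separable closure of $F$; all extensions of $F$ below are taken inside it. For a field $k$ let $k^{(2)}$ denote the compositum of all cyclic extensions of $k$ of degree $p$; let ${F^{(2)}}^{(2)}=(F^{(2)})^{(2)}$, and let $F^{(3)}$ be the compositum of all cyclic extensions of $F^{(2)}$ of degree $p$ which are Galois over $F$. Put $V_F=\mathrm{Gal}({F^{(2)}}^{(2)}/F)$ and $W_F=\mathrm{Gal}(F^{(3)}/F)$, and, for a cyclic extension $E/F$ of degree $p$, $T_{E/F}=\mathrm{Gal}(E^{(2)}/F)$; since $E^{(2)}\subset {F^{(2)}}^{(2)}$, each $\sigma\in V_F$ restricts to an element $\sigma_{E/F}\in T_{E/F}$. For a pro-$p$-group $\Gamma$ let $\Phi(\Gamma)$ denote its Frattini subgroup, i.e. the closed subgroup generated by all $p$th powers and all commutators. Then the following are equivalent: 1. There exists $\sigma\in V_F\setminus\Phi(V_F)$ of order $p$. 2. There exists $\sigma\in W_F\setminus\Phi(W_F)$ of order $p$. 3. There exists $\sigma\in V_F\setminus\Phi(V_F)$ such that for each cyclic extension $E/F$ of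 degree $p$ the image $\sigma_{E/F}\in T_{E/F}$ has order at most $p$. 4. $p=2$ and $F$ is formally real. Moreover, if these conditions hold, then for every $\sigma$ as in (1), (2) or (3) the set of elements $a\in F$ whose square roots are fixed by $\sigma$ is (the set of nonnegative elements of) an ordering of $F$. -/

import Mathlib

namespace SmallGalois

open scoped commutatorElement

/-- `K/k` is a cyclic (Galois) extension of degree `p`. -/
structure IsCyclicExt (p : ℕ) (k K : Type*) [Field k] [Field K] [Algebra k K] : Prop where
  isGalois : IsGalois k K
  isCyclic : IsCyclic Gal(K/k)
  finrank_eq : Module.finrank k K = p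

/-- The compositum `k^{(2)}` inside `Ω` of all cyclic extensions of `k` of degree `p`. -/
def maxElem (p : ℕ) (k Ω : Type*) [Field k] [Field Ω] [Algebra k Ω] : IntermediateField k Ω :=
  ⨆ (K : IntermediateField k Ω) (_ : IsCyclicExt p k K), K

/-- The closed subgroup `Γ^p[Γ,Γ]` of a topological group `Γ`; for a pro-`p`-group this is its
Frattini subgroup `Φ(Γ)`. -/
def Phi (p : ℕ) (Γ : Type*) [Group Γ] [TopologicalSpace Γ] [IsTopologicalGroup Γ] : Subgroup Γ :=
  (Subgroup.closure (Set.range fun g : Γ => g ^ p) ⊔ commutator Γ).topologicalClosure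

section Kummer

variable {k Ω : Type*} [Field k] [Field Ω] [Algebra k Ω] [IsGalois k Ω]

/-- The elements of `k^{(2)}` are those fixed by all `p`-th powers and all commutators of the
absolute Galois group. -/
theorem mem_maxElem_iff {p : ℕ} (hp : p.Prime) (x : Ω) :
    x ∈ maxElem p k Ω ↔ ∀ g h : Gal(Ω/k), (g ^ p) x = x ∧ ⁅g, h⁆ x = x := by
  constructor
  · intro hx g h
    have key : ∀ t : Gal(Ω/k), (∀ K : IntermediateField k Ω, IsCyclicExt p k K →
        t ∈ K.fixingSubgroup) → t x = x := by
      intro t ht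
      have : maxElem p k Ω ≤ IntermediateField.fixedField (Subgroup.zpowers t) := by
        refine iSup₂_le fun K hK => ?_
        rw [IntermediateField.le_iff_le, Subgroup.zpowers_le]
        exact ht K hK
      exact this hx ⟨t, Subgroup.mem_zpowers t⟩
    refine ⟨key _ fun K hK => ?_, key _ fun K hK => ?_⟩
    · have := hK.isGalois
      have : FiniteDimensional k K := Module.finite_of_finrank_pos (by
        rw [hK.finrank_eq]; exact hp.pos)
      rw [← IntermediateField.restrictNormalHom_ker, MonoidHom.mem_ker, map_pow]
      have hc : Nat.card Gal(K/k) = p := by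
        rw [IsGalois.card_aut_eq_finrank, hK.finrank_eq]
      rw [← hc]
      exact pow_card_eq_one'
    · have := hK.isGalois
      have := hK.isCyclic
      rw [← IntermediateField.restrictNormalHom_ker, MonoidHom.mem_ker, map_commutatorElement,
        commutatorElement_eq_one_iff_mul_comm]
      have := IsCyclic.isMulCommutative (α := Gal(K/k))
      exact this.is_comm.comm _ _
  · intro hx
    -- `D`: the normal subfield of all elements fixed by `p`-th powers and commutators
    let N : Subgroup Gal(Ω/k) :=
      Subgroup.closure (Set.range fun g : Gal(Ω/k) => g ^ p) ⊔ commutator Gal(Ω/k)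
    have hNpow : ∀ g : Gal(Ω/k), g ^ p ∈ N := fun g =>
      (le_sup_left : _ ≤ N) (Subgroup.subset_closure ⟨g, rfl⟩)
    have hNcomm : ∀ g h : Gal(Ω/k), ⁅g, h⁆ ∈ N := fun g h =>
      (le_sup_right : _ ≤ N) (Subgroup.commutator_mem_commutator (Subgroup.mem_top g)
        (Subgroup.mem_top h))
    let D : IntermediateField k Ω := IntermediateField.fixedField N
    have hxD : x ∈ D := by
      have hle : N ≤ MulAction.stabilizer Gal(Ω/k) x := by
        refine sup_le ?_ ?_
        · rw [Subgroup.closure_le]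
          rintro _ ⟨g, rfl⟩
          exact (hx g 1).1
        · rw [commutator_def, Subgroup.commutator_le]
          intro g _ h _
          exact (hx g h).2
      rintro ⟨t, ht⟩
      exact hle ht
    have hDn : Normal k D := by
      rw [IntermediateField.normal_iff_forall_map_le']
      rintro s _ ⟨y, hy, rfl⟩ ⟨t, ht⟩
      have h1 : s⁻¹ * t * s ∈ N := by
        have h2 := N.mul_mem ht (hNcomm t⁻¹ s⁻¹)
        have h3 : t * ⁅t⁻¹, s⁻¹⁆ = s⁻¹ * t * s := by
          rw [commutatorElement_def]; group
        rwa [h3] at h2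
      have h4 : (s⁻¹ * t * s) y = y := hy ⟨_, h1⟩
      have h5 : s ((s⁻¹ * t * s) y) = t (s y) := by
        rw [← AlgEquiv.mul_apply, ← AlgEquiv.mul_apply]
        congr 1
        group
      change t (s y) = s y
      rw [← h5, h4]
    let M : IntermediateField k Ω := IntermediateField.adjoin k {x}
    have : FiniteDimensional k M :=
      IntermediateField.adjoin.finiteDimensional (Algebra.IsIntegral.isIntegral x)
    let L : IntermediateField k Ω := IntermediateField.normalClosure k M Ω
    have hLD : L ≤ D := by
      rw [IntermediateField.normalClosure_le_iff_of_normal]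
      exact IntermediateField.adjoin_simple_le_iff.2 hxD
    have hxL : x ∈ L :=
      IntermediateField.le_normalClosure M (IntermediateField.mem_adjoin_simple_self k x)
    have : FiniteDimensional k L := normalClosure.is_finiteDimensional k M Ω
    have : IsGalois k L := IsGalois.normalClosure k M Ω
    let r : Gal(Ω/k) →* Gal(L/k) := AlgEquiv.restrictNormalHom L
    have hr : Function.Surjective r := AlgEquiv.restrictNormalHom_surjective Ω
    have hrN : ∀ t ∈ N, r t = 1 := by
      intro t ht
      rw [← MonoidHom.mem_ker, IntermediateField.restrictNormalHom_ker,
        IntermediateField.mem_fixingSubgroup_iff]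
      intro y hy
      exact hLD hy ⟨t, ht⟩
    let _ : CommGroup Gal(L/k) :=
      { (inferInstance : Group Gal(L/k)) with
        mul_comm := fun a b => by
          obtain ⟨g, rfl⟩ := hr a
          obtain ⟨h, rfl⟩ := hr b
          rw [← commutatorElement_eq_one_iff_mul_comm, ← map_commutatorElement]
          exact hrN _ (hNcomm g h) }
    rw [← InfiniteGalois.fixedField_fixingSubgroup (maxElem p k Ω)]
    rintro ⟨τ, hτ⟩
    change τ x = x
    by_contra hne
    have hrτ : r τ ≠ 1 := by
      intro h
      rw [← MonoidHom.mem_ker, IntermediateField.restrictNormalHom_ker,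
        IntermediateField.mem_fixingSubgroup_iff] at h
      exact hne (h x hxL)
    -- a character of order `p` which is nontrivial at `τ`
    have hexp : NeZero (Monoid.exponent Gal(L/k)) := ⟨Monoid.exponent_ne_zero_of_finite⟩
    have hroots : HasEnoughRootsOfUnity ℂ (Monoid.exponent Gal(L/k)) := inferInstance
    obtain ⟨φ, hφ⟩ :=
      CommGroup.exists_apply_ne_one_of_hasEnoughRootsOfUnity Gal(L/k) ℂ hrτ
    let ψ : Gal(Ω/k) →* ℂˣ := φ.comp r
    have hopen : IsOpen (ψ.ker : Set Gal(Ω/k)) := by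
      refine Subgroup.isOpen_mono (H₁ := L.fixingSubgroup) ?_ L.fixingSubgroup_isOpen
      rw [← IntermediateField.restrictNormalHom_ker]
      intro t ht
      rw [MonoidHom.mem_ker] at ht ⊢
      change φ (r t) = 1
      rw [show r t = 1 from ht, map_one]
    let K : IntermediateField k Ω := IntermediateField.fixedField ψ.ker
    have hKfix : K.fixingSubgroup = ψ.ker :=
      InfiniteGalois.fixingSubgroup_fixedField
        ⟨ψ.ker, Subgroup.isClosed_of_isOpen _ hopen⟩
    have hKgal : IsGalois k K := by
      rw [← InfiniteGalois.normal_iff_isGalois, hKfix]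
      infer_instance
    have hKfin : FiniteDimensional k K := by
      rw [← InfiniteGalois.isOpen_iff_finite, hKfix]
      exact hopen
    let e : Gal(K/k) ≃* ψ.range :=
      (QuotientGroup.quotientKerEquivOfSurjective _
        (AlgEquiv.restrictNormalHom_surjective (F := k) (K₁ := K) Ω)).symm.trans
      ((QuotientGroup.quotientMulEquivOfEq (by
        rw [IntermediateField.restrictNormalHom_ker, hKfix])).trans
      (QuotientGroup.quotientKerEquivRange ψ))
    have : Finite ψ.range := Finite.of_equiv _ e.toEquiv
    have hcyc : IsCyclic ψ.range := inferInstance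
    have hcard : Nat.card ψ.range = p := by
      have hdvd : Monoid.exponent ψ.range ∣ p := by
        rw [Monoid.exponent_dvd_iff_forall_pow_eq_one]
        rintro ⟨_, t, rfl⟩
        apply Subtype.ext
        change (φ (r t)) ^ p = 1
        rw [← map_pow, ← map_pow, hrN _ (hNpow t), map_one]
      rw [IsCyclic.exponent_eq_card] at hdvd
      refine ((Nat.dvd_prime hp).1 hdvd).resolve_left fun h1 => hφ ?_
      have := (Nat.card_eq_one_iff_unique.1 h1).1
      exact congrArg Subtype.val (Subsingleton.elim (⟨ψ τ, τ, rfl⟩ : ψ.range) 1)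
    have hKc : IsCyclicExt p k K := ⟨hKgal, by
      exact isCyclic_of_surjective e.symm e.symm.surjective, by
      rw [← IsGalois.card_aut_eq_finrank, Nat.card_congr e.toEquiv, hcard]⟩
    have hKle : K ≤ maxElem p k Ω := le_iSup₂_of_le K hKc le_rfl
    have : τ ∈ ψ.ker := hKfix ▸ IntermediateField.fixingSubgroup_le hKle hτ
    exact hφ this

/-- The Galois group of `Ω` over `k^{(2)}` is the closed subgroup `G_k^p[G_k,G_k]` of `G_k`. -/
theorem fixingSubgroup_maxElem {p : ℕ} (hp : p.Prime) :
    (maxElem p k Ω).fixingSubgroup = Phi p Gal(Ω/k) := by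
  have h : maxElem p k Ω = IntermediateField.fixedField (Phi p Gal(Ω/k)) := by
    ext x
    rw [mem_maxElem_iff hp]
    constructor
    · intro hx
      let M : IntermediateField k Ω := IntermediateField.adjoin k {x}
      have hle : Phi p Gal(Ω/k) ≤ M.fixingSubgroup := by
        refine Subgroup.topologicalClosure_minimal _ ?_
          (InfiniteGalois.fixingSubgroup_isClosed M)
        have hmem : ∀ t : Gal(Ω/k), t x = x → t ∈ M.fixingSubgroup := by
          intro t ht
          rw [← Subgroup.zpowers_le, ← IntermediateField.le_iff_le,
            IntermediateField.adjoin_simple_le_iff]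
          have : Subgroup.zpowers t ≤ MulAction.stabilizer Gal(Ω/k) x := by
            rw [Subgroup.zpowers_le]; exact ht
          rintro ⟨s, hs⟩
          exact this hs
        refine sup_le ?_ ?_
        · rw [Subgroup.closure_le]
          rintro _ ⟨g, rfl⟩
          exact hmem _ (hx g 1).1
        · rw [commutator_def, Subgroup.commutator_le]
          intro g _ h _
          exact hmem _ (hx g h).2
      rintro ⟨t, ht⟩
      exact (IntermediateField.mem_fixingSubgroup_iff M t).1 (hle ht) x
        (IntermediateField.mem_adjoin_simple_self k x)
    · intro hx g h
      refine ⟨hx ⟨g ^ p, ?_⟩, hx ⟨⁅g, h⁆, ?_⟩⟩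
      · exact Subgroup.le_topologicalClosure _
          ((le_sup_left : _ ≤ _ ⊔ commutator Gal(Ω/k)) (Subgroup.subset_closure ⟨g, rfl⟩))
      · exact Subgroup.le_topologicalClosure _
          ((le_sup_right : commutator Gal(Ω/k) ≤ _)
            (Subgroup.commutator_mem_commutator (Subgroup.mem_top g) (Subgroup.mem_top h)))
  rw [h]
  exact InfiniteGalois.fixingSubgroup_fixedField
    ⟨Phi p Gal(Ω/k), Subgroup.isClosed_topologicalClosure _⟩

end Kummer

section Fields

variable (p : ℕ) (F Ω : Type*) [Field F] [Field Ω] [Algebra F Ω]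

/-- For `F ⊆ E ⊆ Ω`, the field `E^{(2)}`, regarded as an extension of `F`. -/
def second {F Ω : Type*} [Field F] [Field Ω] [Algebra F Ω] (E : IntermediateField F Ω) :
    IntermediateField F Ω :=
  (maxElem p E Ω).restrictScalars F

/-- `(F^{(2)})^{(2)}`, regarded as an extension of `F`. -/
def secondSecond : IntermediateField F Ω :=
  second p (maxElem p F Ω)

/-- `F^{(3)}`: the compositum of all cyclic extensions of `F^{(2)}` of degree `p` which are Galois
over `F`, regarded as an extension of `F`. -/
def third : IntermediateField F Ω :=
  (⨆ (K : IntermediateField (maxElem p F Ω) Ω)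
    (_ : IsCyclicExt p (maxElem p F Ω) K ∧ IsGalois F (K.restrictScalars F)),
      K).restrictScalars F

/-- `V_F = Gal((F^{(2)})^{(2)}/F)`. -/
abbrev VGroup : Type _ := Gal(secondSecond p F Ω/F)

/-- `W_F = Gal(F^{(3)}/F)`. -/
abbrev WGroup : Type _ := Gal(third p F Ω/F)

/-- `T_{E/F} = Gal(E^{(2)}/F)`. By `fixingSubgroup_second` below, this is the quotient of `G_F` by
its closed subgroup `G_E^p[G_E,G_E]`. -/
abbrev TGroup {F Ω : Type*} [Field F] [Field Ω] [Algebra F Ω] (E : IntermediateField F Ω) :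
    Type _ := Gal(second p E/F)

end Fields

section Restriction

variable {F Ω : Type*} [Field F] [Field Ω] [Algebra F Ω]

/-- Restriction of automorphisms from `L` to a subfield `K` that is normal over `F`. -/
noncomputable def restrictHom {K L : IntermediateField F Ω} (h : K ≤ L) [Normal F K] :
    Gal(L/F) →* Gal(K/F) :=
  letI : Algebra K L := (IntermediateField.inclusion h).toRingHom.toAlgebra
  haveI : IsScalarTower F K L := IsScalarTower.of_algHom (IntermediateField.inclusion h)
  AlgEquiv.restrictNormalHom K

theorem coe_restrictHom {K L : IntermediateField F Ω} (h : K ≤ L) [Normal F K]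
    (σ : Gal(L/F)) (x : K) :
    (restrictHom h σ x : Ω) = (σ (IntermediateField.inclusion h x) : Ω) := by
  let _ : Algebra K L := (IntermediateField.inclusion h).toRingHom.toAlgebra
  have : IsScalarTower F K L := IsScalarTower.of_algHom (IntermediateField.inclusion h)
  exact congrArg Subtype.val (AlgEquiv.restrictNormal_commutes σ K x)

variable [IsGalois F Ω]

/-- The Galois group of `Ω` over `E^{(2)}` is the closed subgroup `G_E^p[G_E,G_E]` of `G_F`. -/
theorem fixingSubgroup_second {p : ℕ} (hp : p.Prime) (E : IntermediateField F Ω) :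
    (second p E).fixingSubgroup = (Phi p Gal(Ω/E)).map (AlgEquiv.restrictScalarsHom F) := by
  rw [← fixingSubgroup_maxElem hp]
  ext t
  rw [IntermediateField.mem_fixingSubgroup_iff, Subgroup.mem_map]
  constructor
  · intro ht
    have htE : ∀ c : E, t c = c := fun c =>
      ht c ((maxElem p E Ω).algebraMap_mem c)
    exact ⟨AlgEquiv.ofRingEquiv (f := t.toRingEquiv) htE,
      (IntermediateField.mem_fixingSubgroup_iff _ _).2 ht, rfl⟩
  · rintro ⟨u, hu, rfl⟩
    exact (IntermediateField.mem_fixingSubgroup_iff _ _).1 hu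

theorem normal_second {p : ℕ} (hp : p.Prime) (E : IntermediateField F Ω) [Normal F E] :
    Normal F (second p E) := by
  rw [IntermediateField.normal_iff_forall_map_le']
  rintro s _ ⟨y, hy, rfl⟩
  have hy' := (mem_maxElem_iff hp y).1 hy
  refine (mem_maxElem_iff hp _).2 fun g h => ?_
  have hmap := IntermediateField.normal_iff_forall_map_le'.1 (inferInstance : Normal F E)
  -- conjugation by `s` preserves the Galois group of `Ω/E`
  have conj : ∀ g : Gal(Ω/E), ∃ g' : Gal(Ω/E), ∀ z, s (g' z) = g (s z) := by
    intro g
    refine ⟨AlgEquiv.ofRingEquiv (f := (s.toRingEquiv.trans g.toRingEquiv).trans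
      s.symm.toRingEquiv) ?_, fun z => ?_⟩
    · intro c
      have hc : s c ∈ E := hmap s ⟨c, c.2, rfl⟩
      have : g (s c) = s c := g.commutes ⟨s c, hc⟩
      change s.symm (g (s c)) = c
      rw [this, AlgEquiv.symm_apply_apply]
    · exact s.apply_symm_apply _
  obtain ⟨g', hg⟩ := conj g
  obtain ⟨h', hh⟩ := conj h
  have hinv : ∀ (a a' : Gal(Ω/E)), (∀ z, s (a' z) = a (s z)) →
      ∀ z, s (a'⁻¹ z) = a⁻¹ (s z) := by
    intro a a' ha z
    apply a.injective
    rw [← ha, ← AlgEquiv.mul_apply, ← AlgEquiv.mul_apply, mul_inv_cancel, mul_inv_cancel]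
    rfl
  have hpow : ∀ (n : ℕ) z, s ((g' ^ n) z) = (g ^ n) (s z) := by
    intro n
    induction n with
    | zero => intro z; rfl
    | succ n ih =>
      intro z
      rw [pow_succ, pow_succ, AlgEquiv.mul_apply, AlgEquiv.mul_apply, ih, hg]
  constructor
  · change (g ^ p) (s y) = s y
    rw [← hpow, (hy' g' h').1]
  · change ⁅g, h⁆ (s y) = s y
    have : s (⁅g', h'⁆ y) = ⁅g, h⁆ (s y) := by
      simp only [commutatorElement_def, AlgEquiv.mul_apply]
      rw [hg, hh, hinv g g' hg, hinv h h' hh]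
    rw [← this, (hy' g' h').2]

theorem second_le_secondSecond {p : ℕ} (hp : p.Prime) {E : IntermediateField F Ω}
    (hE : IsCyclicExt p F E) : second p E ≤ secondSecond p F Ω := by
  have hle : E ≤ maxElem p F Ω := le_iSup₂_of_le E hE le_rfl
  intro x hx
  have hx' := (mem_maxElem_iff hp x).1 hx
  refine (mem_maxElem_iff hp x).2 fun g h => ?_
  let lower : Gal(Ω/maxElem p F Ω) →* Gal(Ω/E) :=
    { toFun := fun g => AlgEquiv.ofRingEquiv (f := g.toRingEquiv)
        fun c => g.commutes ⟨c, hle c.2⟩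
      map_one' := rfl
      map_mul' := fun _ _ => rfl }
  have hlow : ∀ (g : Gal(Ω/maxElem p F Ω)) (z : Ω), lower g z = g z := fun _ _ => rfl
  obtain ⟨h1, h2⟩ := hx' (lower g) (lower h)
  rw [← map_pow, hlow] at h1
  rw [← map_commutatorElement, hlow] at h2
  exact ⟨h1, h2⟩

/-- The image `σ_{E/F}` in `T_{E/F}` of an element `σ` of `V_F`: the restriction of `σ` to
`E^{(2)} ⊆ (F^{(2)})^{(2)}`. -/
noncomputable def toT {p : ℕ} (hp : p.Prime) (E : IntermediateField F Ω)
    (hE : IsCyclicExt p F E) : VGroup p F Ω →* TGroup p E :=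
  haveI : IsGalois F E := hE.isGalois
  haveI : Normal F (second p E) := normal_second hp E
  restrictHom (second_le_secondSecond hp hE)

end Restriction

section Orderings

/-- The elements of `F` whose square roots in `L` exist and are fixed by `σ`. (If one square root
is fixed, then so is the other one.) -/
def fixedRoots {F L : Type*} [Field F] [Field L] [Algebra F L] (σ : Gal(L/F)) : Set F :=
  {a | ∃ x : L, x ^ 2 = algebraMap F L a ∧ σ x = x}

/-- `S` is (the set of nonnegative elements of) an ordering of the field `F`. -/
def IsOrderingSet {F : Type*} [Field F] (S : Set F) : Prop :=
  ∃ P : RingPreordering F, P.IsOrdering ∧ (P : Set F) = S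

end Orderings

end SmallGalois

/-!
By Kummer theory `k^{(2)}` is generated by the `p`-th roots of elements of `k`, so `σ` lies outside
the Frattini subgroup exactly when it moves some `θ` with `θ ^ p = a ∈ F`. Let `σ` have order `p`
and let `u ^ p = θ`, `σ u = ω u`, `σ ω = η ω`. Then `ω ^ p = ζ` with `σ θ = ζ θ`, and `σ ^ p u = u`
reads `ζ η ^ (p choose 2) = 1`. For odd `p` this forces `ζ = 1`, which is absurd; hence `p = 2`,
`ω ^ 2 = -1` and `σ ω = -ω`. The set `S` of elements whose square roots are fixed by `σ` is then
multiplicative, contains exactly one of `a`, `-a` for `a ≠ 0`, and is closed under `c ↦ 1 + c`: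
writing `θ = ω √c` and `u = √(1 + θ)`, the norm `u * σ u` is a `σ`-fixed square root of `1 + c`.
So `S` is an ordering. All that is used about `σ` is that `σ ^ p` fixes these `u`, which lie both in
`F^{(3)}` and in `E^{(2)}` for `E = F(θ)`.

Conversely, let `F` be formally real and let `L / F` be a Galois extension with pro-`2` group that
contains `i = √-1`. For a maximal formally real subfield `R` of `L`, every element of `R` with a
square root in `L` is up to sign a square in `R`. Then `R(i)` has no quadratic extension in `L`, so
`R(i) = L`, and the nontrivial automorphism of `L / R` is an involution moving `√-1`.
-/

namespace SmallGalois

open IntermediateField Polynomial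

theorem exists_pow_eq_of_isSepClosed {K : Type*} [Field K] [IsSepClosed K] {n : ℕ} {ξ : K}
    (hn : n ≠ 0) (hξ : IsPrimitiveRoot ξ n) (y : K) : ∃ x : K, x ^ n = y :=
  have := NeZero.mk hn
  have := hξ.neZero'
  IsSepClosed.exists_pow_nat_eq y n

section Kummer

variable {k Ω : Type*} [Field k] [Field Ω] [Algebra k Ω] {n : ℕ} [NeZero n] {ξ : k}

theorem exists_eq_algebraMap_mul_of_pow_eq_pow (hξ : IsPrimitiveRoot ξ n) {x y : Ω}
    (h : y ^ n = x ^ n) : ∃ ζ : k, ζ ^ n = 1 ∧ y = algebraMap k Ω ζ * x := by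
  rcases eq_or_ne x 0 with rfl | hx
  · rw [zero_pow (NeZero.ne n)] at h
    exact ⟨1, one_pow n, by rw [eq_zero_of_pow_eq_zero h, mul_zero]⟩
  · have hyx : (y / x) ^ n = 1 := by rw [div_pow, h, div_self (pow_ne_zero n hx)]
    obtain ⟨i, -, hi⟩ :=
      (hξ.map_of_injective (algebraMap k Ω).injective).eq_pow_of_pow_eq_one hyx
    refine ⟨ξ ^ i, by rw [pow_right_comm, hξ.pow_eq_one, one_pow], ?_⟩
    rw [map_pow, hi, div_mul_cancel₀ y hx]

theorem mem_of_pow_eq_pow (hξ : IsPrimitiveRoot ξ n) {K : IntermediateField k Ω} {x y : Ω}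
    (hx : x ∈ K) (h : y ^ n = x ^ n) : y ∈ K := by
  obtain ⟨ζ, -, rfl⟩ := exists_eq_algebraMap_mul_of_pow_eq_pow hξ h
  exact mul_mem (K.algebraMap_mem ζ) hx

theorem exists_apply_eq_algebraMap_mul (hξ : IsPrimitiveRoot ξ n) (σ : Gal(Ω/k)) {a : k} {θ : Ω}
    (hθ : θ ^ n = algebraMap k Ω a) : ∃ ζ : k, ζ ^ n = 1 ∧ σ θ = algebraMap k Ω ζ * θ :=
  exists_eq_algebraMap_mul_of_pow_eq_pow hξ (by rw [← map_pow, hθ, AlgEquiv.commutes])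

theorem pow_apply_of_apply_eq_algebraMap_mul {σ : Gal(Ω/k)} {θ : Ω} {ζ : k}
    (h : σ θ = algebraMap k Ω ζ * θ) (m : ℕ) : (σ ^ m) θ = algebraMap k Ω (ζ ^ m) * θ := by
  induction m with
  | zero => simp
  | succ m ih =>
    rw [pow_succ', AlgEquiv.mul_apply, ih, map_mul, AlgEquiv.commutes, h, pow_succ, map_mul,
      mul_assoc]

variable {p : ℕ}

theorem dvd_orderOf_of_apply_ne (hp : p.Prime) (hξ : IsPrimitiveRoot ξ p) {σ : Gal(Ω/k)} {a : k}
    {θ : Ω} (hθ : θ ^ p = algebraMap k Ω a) (hσ : σ θ ≠ θ) : p ∣ orderOf σ := by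
  have := Fact.mk hp
  have hθ0 : θ ≠ 0 := by
    rintro rfl
    exact hσ (map_zero σ)
  obtain ⟨ζ, hζ, hσθ⟩ := exists_apply_eq_algebraMap_mul hξ σ hθ
  have hζ1 : ζ ≠ 1 := by
    rintro rfl
    exact hσ (by rw [hσθ, map_one, one_mul])
  rw [← orderOf_eq_prime hζ hζ1]
  refine orderOf_dvd_of_pow_eq_one ((algebraMap k Ω).injective (mul_right_cancel₀ hθ0 ?_))
  rw [← pow_apply_of_apply_eq_algebraMap_mul hσθ, pow_orderOf_eq_one, AlgEquiv.one_apply, map_one,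
    one_mul]

theorem isCyclicExt_adjoin_simple (hp : p.Prime) (hξ : IsPrimitiveRoot ξ p) {a : k} {θ : Ω}
    (hθ : θ ^ p = algebraMap k Ω a) (hk : θ ∉ (algebraMap k Ω).range) :
    IsCyclicExt p k k⟮θ⟯ := by
  have := NeZero.mk hp.ne_zero
  have hirr : Irreducible (X ^ p - C a) := by
    refine X_pow_sub_C_irreducible_of_prime hp fun b hb => hk ?_
    obtain ⟨ζ, -, h⟩ := exists_eq_algebraMap_mul_of_pow_eq_pow hξ (x := algebraMap k Ω b) (y := θ)
      (by rw [hθ, ← hb, map_pow])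
    exact ⟨ζ * b, by rw [h, map_mul]⟩
  have hmonic : (X ^ p - C a).Monic := monic_X_pow_sub_C a hp.ne_zero
  have hint : IsIntegral k θ := ⟨X ^ p - C a, hmonic, by simp [hθ]⟩
  have hfin : Module.finrank k k⟮θ⟯ = p := by
    rw [adjoin.finrank hint, ← minpoly.eq_of_irreducible_of_monic hirr (by simp [hθ]) hmonic,
      natDegree_X_pow_sub_C]
  have : FiniteDimensional k k⟮θ⟯ := adjoin.finiteDimensional hint
  have hroots : (primitiveRoots (Module.finrank k k⟮θ⟯) k).Nonempty :=
    ⟨ξ, by rwa [hfin, mem_primitiveRoots hp.pos]⟩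
  have hgen : ∃ α : k⟮θ⟯, α ^ Module.finrank k k⟮θ⟯ ∈ Set.range (algebraMap k k⟮θ⟯) ∧ k⟮α⟯ = ⊤ :=
    ⟨AdjoinSimple.gen k θ, ⟨a, Subtype.ext (by simpa [hfin] using hθ.symm)⟩,
      lift_injective _ (by rw [lift_adjoin_simple, lift_top, AdjoinSimple.coe_gen])⟩
  obtain ⟨hgal, hcyc⟩ : IsGalois k k⟮θ⟯ ∧ IsCyclic Gal(k⟮θ⟯/k) :=
    ((isCyclic_tfae k k⟮θ⟯ hroots).out 0 2).2 hgen
  exact ⟨hgal, hcyc, hfin⟩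

theorem IsCyclicExt.exists_eq_adjoin_simple (hp : p.Prime) (hξ : IsPrimitiveRoot ξ p)
    {K : IntermediateField k Ω} (hK : IsCyclicExt p k K) :
    ∃ (a : k) (θ : Ω), θ ^ p = algebraMap k Ω a ∧ K = k⟮θ⟯ := by
  obtain ⟨_, _, hfin⟩ := hK
  have : FiniteDimensional k K := Module.finite_of_finrank_pos (hfin ▸ hp.pos)
  obtain ⟨θ, ⟨a, ha⟩, hθ⟩ := exists_root_adjoin_eq_top_of_isCyclic k K
    ⟨ξ, by rwa [hfin, mem_primitiveRoots hp.pos]⟩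
  rw [hfin] at ha
  exact ⟨a, θ, congrArg Subtype.val ha.symm, by rw [← lift_adjoin_simple, hθ, lift_top]⟩

theorem IsCyclicExt.le_maxElem {K : IntermediateField k Ω} (hK : IsCyclicExt p k K) :
    K ≤ maxElem p k Ω :=
  le_iSup₂_of_le K hK le_rfl

theorem mem_maxElem_of_pow_eq (hp : p.Prime) (hξ : IsPrimitiveRoot ξ p) {a : k} {θ : Ω}
    (hθ : θ ^ p = algebraMap k Ω a) : θ ∈ maxElem p k Ω := by
  by_cases hk : θ ∈ (algebraMap k Ω).range
  · obtain ⟨b, rfl⟩ := hk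
    exact IntermediateField.algebraMap_mem _ b
  · exact (isCyclicExt_adjoin_simple hp hξ hθ hk).le_maxElem (mem_adjoin_simple_self k θ)

theorem maxElem_eq_adjoin (hp : p.Prime) (hξ : IsPrimitiveRoot ξ p) :
    maxElem p k Ω = adjoin k {θ : Ω | ∃ a : k, θ ^ p = algebraMap k Ω a} := by
  refine le_antisymm (iSup₂_le fun K hK => ?_)
    (adjoin_le_iff.2 fun θ ⟨a, hθ⟩ => mem_maxElem_of_pow_eq hp hξ hθ)
  obtain ⟨a, θ, hθ, rfl⟩ := hK.exists_eq_adjoin_simple hp hξ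
  exact adjoin.mono k _ _ (Set.singleton_subset_iff.2 ⟨a, hθ⟩)

theorem notMem_Phi_iff [IsGalois k Ω] (hp : p.Prime) (hξ : IsPrimitiveRoot ξ p)
    {σ : Gal(Ω/k)} :
    σ ∉ Phi p Gal(Ω/k) ↔ ∃ (a : k) (θ : Ω), θ ^ p = algebraMap k Ω a ∧ σ θ ≠ θ := by
  have h : σ ∈ Phi p Gal(Ω/k) ↔ ∀ θ : Ω, (∃ a : k, θ ^ p = algebraMap k Ω a) → σ θ = θ := by
    rw [← fixingSubgroup_maxElem hp, maxElem_eq_adjoin hp hξ,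
      IntermediateField.mem_fixingSubgroup_iff]
    exact forall_mem_adjoin_smul_eq_self_iff k σ
  rw [h]
  push Not
  rw [exists_comm]
  simp only [exists_and_right]

end Kummer

section Orderings

variable {F L : Type*} [Field F] [Field L] [Algebra F L] {σ : Gal(L/F)}

theorem pow_apply_eq_pow_mul_pow_choose_mul {u ω : L} {η : F} (hu : σ u = ω * u)
    (hω : σ ω = algebraMap F L η * ω) (n : ℕ) :
    (σ ^ n) u = ω ^ n * algebraMap F L (η ^ n.choose 2) * u := by
  induction n with
  | zero => simp
  | succ n ih =>
    rw [pow_succ', AlgEquiv.mul_apply, ih, map_mul, map_mul, map_pow, AlgEquiv.commutes, hu, hω,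
      Nat.choose_succ_succ' n 1, Nat.choose_one_right, map_pow, map_pow]
    ring

theorem eq_two_and_exists_sq_eq_neg_one {p : ℕ} {ξ : F} (hp : p.Prime) (hξ : IsPrimitiveRoot ξ p)
    {a : F} {θ u : L} (hθ : θ ^ p = algebraMap F L a) (hσ : σ θ ≠ θ) (hu : u ^ p = θ)
    (hσu : (σ ^ p) u = u) : p = 2 ∧ ∃ ω : L, ω ^ 2 = -1 ∧ σ ω ≠ ω := by
  have := NeZero.mk hp.ne_zero
  have hθ0 : θ ≠ 0 := by
    rintro rfl
    exact hσ (map_zero σ)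
  have hu0 : u ≠ 0 := by
    rintro rfl
    exact hθ0 (by rw [← hu, zero_pow hp.ne_zero])
  obtain ⟨ζ, hζ, hσθ⟩ := exists_apply_eq_algebraMap_mul hξ σ hθ
  have hζ1 : ζ ≠ 1 := by
    rintro rfl
    exact hσ (by rw [hσθ, map_one, one_mul])
  obtain ⟨ω, hσu_eq⟩ : ∃ ω, σ u = ω * u := ⟨σ u / u, (div_mul_cancel₀ _ hu0).symm⟩
  have hωp : ω ^ p = algebraMap F L ζ :=
    mul_right_cancel₀ hθ0 (by rw [← hσθ, ← hu, map_pow, hσu_eq, mul_pow])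
  obtain ⟨η, hη, hσω⟩ := exists_apply_eq_algebraMap_mul hξ σ hωp
  -- `σ ^ p` multiplies `u` by `ζ * η ^ (p choose 2)`, and `p ∣ p choose 2` unless `p = 2`.
  have hζη : ζ * η ^ p.choose 2 = 1 := by
    refine (algebraMap F L).injective (mul_right_cancel₀ hu0 ?_)
    rw [map_mul, ← hωp, ← pow_apply_eq_pow_mul_pow_choose_mul hσu_eq hσω, hσu, map_one, one_mul]
  rcases hp.eq_two_or_odd' with rfl | hodd
  · rw [Nat.choose_self, pow_one] at hζη
    refine ⟨rfl, ω, ?_, fun h => hζ1 ?_⟩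
    · rw [hωp, (sq_eq_one_iff.1 hζ).resolve_left hζ1, map_neg, map_one]
    · have hω0 : ω ≠ 0 := by
        rintro rfl
        exact hu0 ((map_eq_zero_iff σ σ.injective).1 (by rw [hσu_eq, zero_mul]))
      have hη1 : η = 1 := (algebraMap F L).injective
        (mul_right_cancel₀ hω0 (by rw [← hσω, h, map_one, one_mul]))
      rwa [hη1, mul_one] at hζη
  · obtain ⟨m, hm⟩ : p ∣ p.choose 2 := hp.dvd_choose_self two_ne_zero
      (hp.two_le.lt_of_ne (by rintro rfl; exact absurd hodd (by decide)))
    rw [hm, pow_mul, hη, one_pow, mul_one] at hζη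
    exact absurd hζη hζ1

theorem isOrderingSet_of_one_add_mem {S : Set F} (hmul : ∀ x ∈ S, ∀ y ∈ S, x * y ∈ S)
    (hsq : ∀ x, x * x ∈ S) (hor : ∀ x, x ∈ S ∨ -x ∈ S) (hneg : -1 ∉ S)
    (hone : ∀ x ∈ S, 1 + x ∈ S) : IsOrderingSet S := by
  have hadd : ∀ {x y : F}, x ∈ S → y ∈ S → x + y ∈ S := by
    intro x y hx hy
    rcases eq_or_ne y 0 with rfl | hy0
    · rwa [add_zero]
    · have hdiv : x / y ∈ S := by
        have h := hmul _ (hmul x hx y hy) _ (hsq y⁻¹)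
        rwa [mul_assoc, mul_inv_cancel_left₀ hy0, ← div_eq_mul_inv] at h
      have h := hmul _ (hone _ hdiv) y hy
      rwa [add_mul, one_mul, div_mul_cancel₀ x hy0, add_comm] at h
  let P : RingPreordering F :=
    RingPreordering.mk' S hadd (fun {x y} hx hy => hmul x hx y hy) hsq hneg
  refine ⟨P, RingPreordering.isOrdering_iff.2 fun a b hab => ?_, rfl⟩
  by_contra! hcon
  have ha : -a ∈ P := (hor a).resolve_left hcon.1
  have hb : -b ∈ P := (hor b).resolve_left hcon.2
  have h0 : a * b = 0 := P.eq_zero_of_mem_of_neg_mem (neg_mul_neg a b ▸ mul_mem ha hb) hab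
  rcases mul_eq_zero.1 h0 with rfl | rfl
  · exact hcon.1 (zero_mem P)
  · exact hcon.2 (zero_mem P)

theorem isFormallyReal_iff_not_isSumSq_neg_one : IsFormallyReal F ↔ ¬ IsSumSq (-1 : F) := by
  refine ⟨fun _ h => one_ne_zero
    (IsFormallyReal.eq_zero_of_add_right IsSumSq.one h (add_neg_cancel 1)), fun h => ?_⟩
  refine IsFormallyReal.of_eq_zero_of_eq_zero_of_mul_self_add fun {s a} hs hsa => ?_
  by_contra ha
  refine h ?_
  have hneg : -1 = s * (a⁻¹ * a⁻¹) := by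
    field_simp
    linear_combination -hsa
  rw [hneg]
  exact hs.mul (IsSumSq.mul_self a⁻¹)

instance charZero_of_isFormallyReal [IsFormallyReal F] : CharZero F :=
  have : IsSemireal F :=
    .of_not_isSumSq_neg_one (isFormallyReal_iff_not_isSumSq_neg_one.1 inferInstance)
  inferInstance

theorem IsOrderingSet.isFormallyReal {S : Set F} (h : IsOrderingSet S) : IsFormallyReal F := by
  obtain ⟨P, -, -⟩ := h
  exact isFormallyReal_iff_not_isSumSq_neg_one.2 fun hneg =>
    RingPreordering.neg_one_notMem P (P.mem_of_isSumSq hneg)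

theorem mul_self_mem_fixedRoots (σ : Gal(L/F)) (x : F) : x * x ∈ fixedRoots σ :=
  ⟨algebraMap F L x, by rw [map_mul, sq], σ.commutes x⟩

theorem mul_mem_fixedRoots {x y : F} (hx : x ∈ fixedRoots σ) (hy : y ∈ fixedRoots σ) :
    x * y ∈ fixedRoots σ := by
  obtain ⟨s, hs, hσs⟩ := hx
  obtain ⟨t, ht, hσt⟩ := hy
  exact ⟨s * t, by rw [mul_pow, hs, ht, map_mul], by rw [map_mul, hσs, hσt]⟩

theorem apply_eq_or_eq_neg_of_sq_eq (σ : Gal(L/F)) {a : F} {x : L} (hx : x ^ 2 = algebraMap F L a) :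
    σ x = x ∨ σ x = -x := by
  rw [← sq_eq_sq_iff_eq_or_eq_neg, ← map_pow, hx, AlgEquiv.commutes]

section SqrtNegOne

variable {ω : L} (hω : ω ^ 2 = -1) (hσω : σ ω ≠ ω)
include hω hσω

theorem apply_eq_neg_of_sq_eq_neg_one : σ ω = -ω :=
  (apply_eq_or_eq_neg_of_sq_eq σ (a := -1) (by rw [hω, map_neg, map_one])).resolve_left hσω

theorem neg_one_notMem_fixedRoots : -1 ∉ fixedRoots σ := by
  rintro ⟨x, hx, hσx⟩
  rw [map_neg, map_one, ← hω, sq_eq_sq_iff_eq_or_eq_neg] at hx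
  rcases hx with rfl | rfl
  · exact hσω hσx
  · exact hσω (neg_injective (by rw [← map_neg, hσx]))

theorem mem_fixedRoots_or_neg_mem_of_sq_eq {a : F} {x : L} (hx : x ^ 2 = algebraMap F L a) :
    a ∈ fixedRoots σ ∨ -a ∈ fixedRoots σ := by
  rcases apply_eq_or_eq_neg_of_sq_eq σ hx with h | h
  · exact Or.inl ⟨x, hx, h⟩
  · exact Or.inr ⟨ω * x, by rw [mul_pow, hω, hx, map_neg, neg_one_mul],
      by rw [map_mul, apply_eq_neg_of_sq_eq_neg_one hω hσω, h, neg_mul_neg]⟩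

theorem one_add_mem_fixedRoots
    (hsqrt : ∀ (a : F) (θ : L), θ ^ 2 = algebraMap F L a → σ θ ≠ θ →
      ∃ u : L, u ^ 2 = 1 + θ ∧ (σ ^ 2) u = u) {c : F} (hc : c ∈ fixedRoots σ) :
    1 + c ∈ fixedRoots σ := by
  -- If `s ^ 2 = c` with `σ s = s`, then `θ = ω * s` satisfies `σ θ = -θ` and
  -- `(1 + θ) * (1 - θ) = 1 + c`, so `u * σ u` is a square root of `1 + c`.
  obtain ⟨s, hs, hσs⟩ := hc
  rcases eq_or_ne s 0 with rfl | hs0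
  · have hc0 : c = 0 := by simpa using hs.symm
    simpa [hc0] using mul_self_mem_fixedRoots σ 1
  · have hσθ : σ (ω * s) = -(ω * s) := by
      rw [map_mul, apply_eq_neg_of_sq_eq_neg_one hω hσω, hσs, neg_mul]
    have hθ : (ω * s) ^ 2 = algebraMap F L (-c) := by
      rw [mul_pow, hω, hs, map_neg, neg_one_mul]
    obtain ⟨u, hu, hσu⟩ := hsqrt (-c) (ω * s) hθ fun h =>
      hσω (mul_right_cancel₀ hs0 (by rwa [map_mul, hσs] at h))
    rw [sq, AlgEquiv.mul_apply] at hσu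
    refine ⟨u * σ u, ?_, by rw [map_mul, hσu, mul_comm]⟩
    rw [map_neg] at hθ
    rw [mul_pow, ← map_pow, hu, map_add, map_one, hσθ, map_add, map_one]
    linear_combination -hθ

end SqrtNegOne

theorem eq_two_and_isOrderingSet_fixedRoots [IsGalois F L] {p : ℕ} {ξ : F} (hp : p.Prime)
    (hξ : IsPrimitiveRoot ξ p) (hσ : σ ∉ Phi p Gal(L/F))
    (hroot : ∀ a : F, ∃ x : L, x ^ p = algebraMap F L a)
    (hfix : ∀ (a : F) (θ : L), θ ^ p = algebraMap F L a → σ θ ≠ θ →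
      (∃ u : L, u ^ p = θ ∧ (σ ^ p) u = u) ∧
        (p = 2 → ∃ u : L, u ^ p = 1 + θ ∧ (σ ^ p) u = u)) :
    p = 2 ∧ IsOrderingSet (fixedRoots σ) := by
  obtain ⟨a, θ, hθ, hσθ⟩ := (notMem_Phi_iff hp hξ).1 hσ
  obtain ⟨u, hu, hσu⟩ := (hfix a θ hθ hσθ).1
  obtain ⟨rfl, ω, hω, hσω⟩ := eq_two_and_exists_sq_eq_neg_one hp hξ hθ hσθ hu hσu
  refine ⟨rfl, isOrderingSet_of_one_add_mem (fun _ hx _ hy => mul_mem_fixedRoots hx hy)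
    (mul_self_mem_fixedRoots σ) (fun b => ?_) (neg_one_notMem_fixedRoots hω hσω)
    (fun c hc => one_add_mem_fixedRoots hω hσω (fun a θ hθ hσθ => (hfix a θ hθ hσθ).2 rfl) hc)⟩
  obtain ⟨x, hx⟩ := hroot b
  exact mem_fixedRoots_or_neg_mem_of_sq_eq hω hσω hx

end Orderings

section Third

variable {F Ω : Type*} [Field F] [Field Ω] [Algebra F Ω] {p : ℕ}

theorem normal_iSup₂ {ι : Type*} {q : ι → Prop} {K : ι → IntermediateField F Ω}
    (h : ∀ i, q i → Normal F (K i)) : Normal F (⨆ (i) (_ : q i), K i : IntermediateField F Ω) := by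
  rw [iSup_subtype']
  exact normal_iSup F Ω _ (h := fun i => h i i.2)

theorem third_eq_sup_iSup : third p F Ω = maxElem p F Ω ⊔
    ⨆ (K : IntermediateField (maxElem p F Ω) Ω)
      (_ : IsCyclicExt p (maxElem p F Ω) K ∧ IsGalois F (K.restrictScalars F)),
      K.restrictScalars F := by
  apply le_antisymm
  · refine (le_extendScalars_iff le_sup_left _).1 (iSup₂_le fun K hK => ?_)
    exact (le_extendScalars_iff _ K).2 (le_sup_of_le_right (le_iSup₂_of_le K hK le_rfl))
  · refine sup_le (fun x hx => ?_) (iSup₂_le fun K hK x hx => ?_)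
    · exact IntermediateField.algebraMap_mem _ (⟨x, hx⟩ : maxElem p F Ω)
    · exact SetLike.le_def.1 (le_iSup₂_of_le (f := fun K _ => K) K hK le_rfl) hx

theorem maxElem_le_third : maxElem p F Ω ≤ third p F Ω := by
  rw [third_eq_sup_iSup]
  exact le_sup_left

theorem restrictScalars_le_third {K : IntermediateField (maxElem p F Ω) Ω}
    (hK : IsCyclicExt p (maxElem p F Ω) K) (hKF : IsGalois F (K.restrictScalars F)) :
    K.restrictScalars F ≤ third p F Ω := by
  rw [third_eq_sup_iSup]
  exact le_sup_of_le_right (le_iSup₂_of_le K ⟨hK, hKF⟩ le_rfl)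

theorem maxElem_le_secondSecond : maxElem p F Ω ≤ secondSecond p F Ω := fun x hx =>
  (maxElem p (maxElem p F Ω) Ω).algebraMap_mem ⟨x, hx⟩

theorem third_le_secondSecond : third p F Ω ≤ secondSecond p F Ω := by
  rw [third_eq_sup_iSup]
  exact sup_le maxElem_le_secondSecond (iSup₂_le fun K hK => hK.1.le_maxElem)

instance normal_maxElem : Normal F (maxElem p F Ω) :=
  normal_iSup₂ fun _ hK => hK.isGalois.to_normal

instance normal_third : Normal F (third p F Ω) := by
  rw [third_eq_sup_iSup]
  exact @normal_sup F Ω _ _ _ _ _ normal_maxElem (normal_iSup₂ fun K hK => hK.2.to_normal)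

theorem normal_restrictScalars_adjoin [Normal F Ω] (M : IntermediateField F Ω) [Normal F M]
    {S : Set Ω} (hS : ∀ g : Gal(Ω/F), ∀ x ∈ S, g x ∈ adjoin M S) :
    Normal F ((adjoin M S).restrictScalars F) := by
  rw [normal_iff_forall_map_le']
  intro g
  nth_rw 1 [restrictScalars_adjoin]
  rw [adjoin_map, adjoin_le_iff]
  rintro _ ⟨x, hx | hx, rfl⟩
  · have hgx : g x ∈ M := normal_iff_forall_map_le'.1 ‹_› g ⟨x, hx, rfl⟩
    exact (adjoin M S).algebraMap_mem ⟨g x, hgx⟩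
  · exact hS g x hx

section Galois

variable [IsGalois F Ω]

instance isGalois_third : IsGalois F (third p F Ω) where

theorem isGalois_secondSecond (hp : p.Prime) : IsGalois F (secondSecond p F Ω) where
  to_normal := normal_second hp _

variable {ξ : F}

theorem mem_third_of_pow_mem (hp : p.Prime) (hξ : IsPrimitiveRoot ξ p) {u : Ω}
    (hu : u ^ p ∈ maxElem p F Ω) (hconj : ∀ g : Gal(Ω/F), g u ∈ (maxElem p F Ω)⟮u⟯) :
    u ∈ third p F Ω := by
  by_cases huM : u ∈ maxElem p F Ω
  · exact maxElem_le_third huM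
  have hcyc : IsCyclicExt p (maxElem p F Ω) (maxElem p F Ω)⟮u⟯ :=
    isCyclicExt_adjoin_simple hp
      (hξ.map_of_injective (algebraMap F (maxElem p F Ω)).injective)
      (a := ⟨u ^ p, hu⟩) rfl (by rintro ⟨c, rfl⟩; exact huM c.2)
  have := normal_restrictScalars_adjoin (maxElem p F Ω) (S := {u}) (by simpa using hconj)
  exact restrictScalars_le_third hcyc ⟨⟩ (mem_adjoin_simple_self _ u)

theorem root_mem_third (hp : p.Prime) (hξ : IsPrimitiveRoot ξ p)
    (hΩ : ∀ y : Ω, ∃ x : Ω, x ^ p = y) {a : F} {θ u : Ω} (hθ : θ ^ p = algebraMap F Ω a)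
    (hu : u ^ p = θ) : u ∈ third p F Ω := by
  have := NeZero.mk hp.ne_zero
  refine mem_third_of_pow_mem hp hξ (hu ▸ mem_maxElem_of_pow_eq hp hξ hθ) fun g => ?_
  obtain ⟨ζ, -, hζ⟩ := exists_apply_eq_algebraMap_mul hξ g hθ
  obtain ⟨ω, hω⟩ := hΩ (algebraMap F Ω ζ)
  have hωM : ω ∈ (maxElem p F Ω)⟮u⟯ := IntermediateField.algebraMap_mem _
    (⟨ω, mem_maxElem_of_pow_eq hp hξ hω⟩ : maxElem p F Ω)
  refine mem_of_pow_eq_pow (hξ.map_of_injective (algebraMap F (maxElem p F Ω)).injective)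
    (mul_mem hωM (mem_adjoin_simple_self _ u)) ?_
  rw [← map_pow, hu, hζ, mul_pow, hω, hu]

theorem sqrt_one_add_mem_third (hξ : IsPrimitiveRoot ξ 2) (hΩ : ∀ y : Ω, ∃ x : Ω, x ^ 2 = y)
    {a : F} {θ u : Ω} (hθ : θ ^ 2 = algebraMap F Ω a) (hu : u ^ 2 = 1 + θ) :
    u ∈ third 2 F Ω := by
  -- A conjugate of `√(1 + θ)` is `±√(1 ± θ)`, and `√(1 + θ) * √(1 - θ) = √(1 - a)` lies in
  -- `F^{(2)}`.
  have hp := Nat.prime_two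
  have hθM : θ ∈ maxElem 2 F Ω := mem_maxElem_of_pow_eq hp hξ hθ
  have hξM := hξ.map_of_injective (algebraMap F (maxElem 2 F Ω)).injective
  refine mem_third_of_pow_mem hp hξ (hu ▸ add_mem (one_mem _) hθM) fun g => ?_
  have huM := mem_adjoin_simple_self (maxElem 2 F Ω) u
  have hgu : g u ^ 2 = 1 + g θ := by rw [← map_pow, hu, map_add, map_one]
  rcases apply_eq_or_eq_neg_of_sq_eq g hθ with h | h
  · exact mem_of_pow_eq_pow hξM huM (by rw [hgu, h, hu])
  · obtain ⟨β, hβ⟩ := hΩ (algebraMap F Ω (1 - a))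
    have hβM : β ∈ (maxElem 2 F Ω)⟮u⟯ := IntermediateField.algebraMap_mem _
      (⟨β, mem_maxElem_of_pow_eq hp hξ hβ⟩ : maxElem 2 F Ω)
    rcases eq_or_ne u 0 with rfl | hu0
    · simp
    refine mem_of_pow_eq_pow hξM (mul_mem hβM (inv_mem huM)) ?_
    rw [mul_pow, hβ, inv_pow, ← div_eq_mul_inv, eq_div_iff (pow_ne_zero 2 hu0), hgu, h, hu,
      map_sub, map_one, ← hθ]
    ring

theorem eq_two_and_isOrderingSet_of_third (hp : p.Prime) (hξ : IsPrimitiveRoot ξ p)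
    (hΩ : ∀ y : Ω, ∃ x : Ω, x ^ p = y) {σ : WGroup p F Ω} (hσ : σ ∉ Phi p (WGroup p F Ω))
    (hord : orderOf σ = p) : p = 2 ∧ IsOrderingSet (fixedRoots σ) := by
  have hσp (u : third p F Ω) : (σ ^ p) u = u := by
    rw [orderOf_dvd_iff_pow_eq_one.1 hord.dvd, AlgEquiv.one_apply]
  refine eq_two_and_isOrderingSet_fixedRoots hp hξ hσ (fun a => ?_)
    fun a θ hθ _ => ⟨?_, ?_⟩
  · obtain ⟨x, hx⟩ := hΩ (algebraMap F Ω a)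
    exact ⟨⟨x, maxElem_le_third (mem_maxElem_of_pow_eq hp hξ hx)⟩, Subtype.ext hx⟩
  · obtain ⟨u, hu⟩ := hΩ θ
    exact ⟨⟨u, root_mem_third hp hξ hΩ (congrArg Subtype.val hθ) hu⟩, Subtype.ext hu, hσp _⟩
  · rintro rfl
    obtain ⟨u, hu⟩ := hΩ (1 + θ)
    exact ⟨⟨u, sqrt_one_add_mem_third hξ hΩ (congrArg Subtype.val hθ) hu⟩, Subtype.ext hu, hσp _⟩

end Galois

end Third

section Second

variable {F Ω : Type*} [Field F] [Field Ω] [Algebra F Ω] {p : ℕ} {ξ : F}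

theorem le_second (E : IntermediateField F Ω) : E ≤ second p E := fun x hx =>
  (maxElem p E Ω).algebraMap_mem ⟨x, hx⟩

theorem mem_second_of_pow_mem (hp : p.Prime) (hξ : IsPrimitiveRoot ξ p) {E : IntermediateField F Ω}
    {u : Ω} (hu : u ^ p ∈ E) : u ∈ second p E :=
  mem_maxElem_of_pow_eq hp (hξ.map_of_injective (algebraMap F E).injective) (a := ⟨u ^ p, hu⟩) rfl

variable [IsGalois F Ω]

theorem coe_toT (hp : p.Prime) {E : IntermediateField F Ω} (hE : IsCyclicExt p F E)
    (σ : VGroup p F Ω) (x : second p E) :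
    (toT hp E hE σ x : Ω) = (σ (inclusion (second_le_secondSecond hp hE) x) : Ω) :=
  have : IsGalois F E := hE.isGalois
  have : Normal F (second p E) := normal_second hp E
  coe_restrictHom _ σ x

theorem pow_apply_eq_of_toT_pow_eq_one (hp : p.Prime) {E : IntermediateField F Ω}
    (hE : IsCyclicExt p F E) {σ : VGroup p F Ω} {n : ℕ} (hσ : toT hp E hE σ ^ n = 1)
    {u : secondSecond p F Ω} (hu : (u : Ω) ∈ second p E) : (σ ^ n) u = u := by
  have h := coe_toT hp hE (σ ^ n) ⟨u, hu⟩
  rw [map_pow, hσ, AlgEquiv.one_apply] at h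
  exact Subtype.ext h.symm

theorem toT_pow_eq_one (hp : p.Prime) (hξ : IsPrimitiveRoot ξ p) {E : IntermediateField F Ω}
    (hE : IsCyclicExt p F E) {σ : VGroup p F Ω} {a : F} {θ : secondSecond p F Ω}
    (hθ : θ ^ p = algebraMap F _ a) (hθE : (θ : Ω) ∈ E) (hσθ : σ θ ≠ θ)
    (hfin : IsOfFinOrder (toT hp E hE σ)) (hle : orderOf (toT hp E hE σ) ≤ p) :
    toT hp E hE σ ^ p = 1 := by
  have hθa : (⟨θ, le_second E hθE⟩ : second p E) ^ p = algebraMap F _ a :=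
    Subtype.ext (show (θ : Ω) ^ p = algebraMap F Ω a from congrArg Subtype.val hθ)
  have hdvd : p ∣ orderOf (toT hp E hE σ) :=
    dvd_orderOf_of_apply_ne hp hξ hθa fun h =>
      hσθ (Subtype.ext ((coe_toT hp hE σ _).symm.trans (congrArg Subtype.val h)))
  have hord := hle.antisymm (Nat.le_of_dvd hfin.orderOf_pos hdvd)
  exact orderOf_dvd_iff_pow_eq_one.1 hord.dvd

theorem eq_two_and_isOrderingSet_of_toT (hp : p.Prime) (hξ : IsPrimitiveRoot ξ p)
    (hΩ : ∀ y : Ω, ∃ x : Ω, x ^ p = y) {σ : VGroup p F Ω} (hσ : σ ∉ Phi p (VGroup p F Ω))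
    (hT : ∀ (E : IntermediateField F Ω) (hE : IsCyclicExt p F E),
      IsOfFinOrder (toT hp E hE σ) ∧ orderOf (toT hp E hE σ) ≤ p) :
    p = 2 ∧ IsOrderingSet (fixedRoots σ) := by
  have := isGalois_secondSecond (F := F) (Ω := Ω) hp
  refine eq_two_and_isOrderingSet_fixedRoots hp hξ hσ (fun a => ?_) fun a θ hθ hσθ => ?_
  · obtain ⟨x, hx⟩ := hΩ (algebraMap F Ω a)
    exact ⟨⟨x, maxElem_le_secondSecond (mem_maxElem_of_pow_eq hp hξ hx)⟩, Subtype.ext hx⟩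
  have hE : IsCyclicExt p F F⟮(θ : Ω)⟯ :=
    isCyclicExt_adjoin_simple hp hξ (congrArg Subtype.val hθ) fun ⟨c, hc⟩ =>
      hσθ (by rw [← show algebraMap F _ c = θ from Subtype.ext hc, AlgEquiv.commutes])
  have hθE : (θ : Ω) ∈ F⟮(θ : Ω)⟯ := mem_adjoin_simple_self F _
  have hσp := toT_pow_eq_one hp hξ hE hθ hθE hσθ (hT _ hE).1 (hT _ hE).2
  have hfix : ∀ y : secondSecond p F Ω, (y : Ω) ∈ F⟮(θ : Ω)⟯ →
      ∃ u : secondSecond p F Ω, u ^ p = y ∧ (σ ^ p) u = u := by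
    intro y hy
    obtain ⟨u, hu⟩ := hΩ y
    have huE : u ∈ second p F⟮(θ : Ω)⟯ := mem_second_of_pow_mem hp hξ (hu ▸ hy)
    exact ⟨⟨u, second_le_secondSecond hp hE huE⟩, Subtype.ext hu,
      pow_apply_eq_of_toT_pow_eq_one hp hE hσp huE⟩
  exact ⟨hfix θ hθE, fun _ => hfix (1 + θ) (add_mem (one_mem _) hθE)⟩

end Second

section FormallyReal

theorem isSumSq_map {A B : Type*} [Semiring A] [Semiring B] (f : A →+* B) {s : A}
    (hs : IsSumSq s) : IsSumSq (f s) := by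
  induction hs with
  | zero => rw [map_zero]; exact IsSumSq.zero
  | sq_add a _ ih => rw [map_add, map_mul]; exact IsSumSq.sq_add _ ih

variable {F L : Type*} [Field F] [Field L] [Algebra F L]

theorem exists_eq_add_mul_of_mem_adjoin_sqrt {x y : L} {a : F} (hx : x ^ 2 = algebraMap F L a)
    (hy : y ∈ F⟮x⟯) : ∃ s t : F, y = algebraMap F L s + algebraMap F L t * x := by
  have hmonic : (X ^ 2 - C a).Monic := monic_X_pow_sub_C a two_ne_zero
  have hroot : aeval x (X ^ 2 - C a) = 0 := by simp [hx]
  have hint : IsAlgebraic F x := ⟨X ^ 2 - C a, hmonic.ne_zero, hroot⟩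
  rw [← mem_toSubalgebra, adjoin_simple_toSubalgebra_of_isAlgebraic hint,
    Algebra.adjoin_singleton_eq_range_aeval] at hy
  obtain ⟨q, rfl⟩ := hy
  have hdeg : (q %ₘ (X ^ 2 - C a)).natDegree ≤ 1 := by
    refine Nat.le_of_lt_succ ((natDegree_modByMonic_lt q hmonic fun h => ?_).trans_eq
      natDegree_X_pow_sub_C)
    simpa using congrArg natDegree h
  obtain ⟨t, s, hq⟩ := exists_eq_X_add_C_of_natDegree_le_one hdeg
  refine ⟨s, t, ?_⟩
  change aeval x q = _
  rw [← aeval_modByMonic_eq_self_of_root hroot, hq]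
  simp [add_comm]

theorem exists_eq_of_isSumSq_adjoin_sqrt {x : L} {a : F} (hx : x ^ 2 = algebraMap F L a)
    {y : F⟮x⟯} (hy : IsSumSq y) : ∃ s t r : F, IsSumSq s ∧ IsSumSq t ∧
      (y : L) = algebraMap F L (s + a * t) + algebraMap F L r * x := by
  induction hy with
  | zero => exact ⟨0, 0, 0, IsSumSq.zero, IsSumSq.zero, by simp⟩
  | @sq_add b y _ ih =>
    obtain ⟨s, t, r, hs, ht, h⟩ := ih
    obtain ⟨c, d, hb⟩ := exists_eq_add_mul_of_mem_adjoin_sqrt hx b.2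
    refine ⟨c * c + s, d * d + t, 2 * c * d + r, IsSumSq.sq_add c hs, IsSumSq.sq_add d ht, ?_⟩
    rw [AddMemClass.coe_add, MulMemClass.coe_mul, h, hb]
    simp only [map_add, map_mul, map_ofNat, ← hx]
    ring

theorem isSumSq_neg_of_not_isFormallyReal_adjoin [IsFormallyReal F] {x : L} {a : F}
    (hx : x ^ 2 = algebraMap F L a) (hxF : x ∉ (algebraMap F L).range)
    (h : ¬ IsFormallyReal F⟮x⟯) : IsSumSq (-a) := by
  rw [isFormallyReal_iff_not_isSumSq_neg_one, not_not] at h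
  obtain ⟨s, t, r, hs, ht, hst⟩ := exists_eq_of_isSumSq_adjoin_sqrt hx h
  replace hst : -1 = algebraMap F L (s + a * t) + algebraMap F L r * x := hst
  have hr : r = 0 := by
    by_contra hr
    refine hxF ⟨(-1 - (s + a * t)) / r, ?_⟩
    rw [map_div₀, div_eq_iff ((_root_.map_ne_zero _).2 hr), map_sub, map_neg, map_one]
    linear_combination hst
  have hneg : -1 = s + a * t := (algebraMap F L).injective (by
    rw [map_neg, map_one, hst, hr, map_zero, zero_mul, add_zero])
  have ht0 : t ≠ 0 := by
    rintro rfl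
    rw [mul_zero, add_zero] at hneg
    exact isFormallyReal_iff_not_isSumSq_neg_one.1 ‹_› (hneg ▸ hs)
  have ha : -a = (1 + s) * t * (t⁻¹ * t⁻¹) := by
    field_simp
    linear_combination hneg
  rw [ha]
  exact ((IsSumSq.one.add hs).mul ht).mul (IsSumSq.mul_self _)

section Directed

variable {c : Set (IntermediateField F L)} (hne : c.Nonempty) (hdir : DirectedOn (· ≤ ·) c)
include hne hdir

theorem mem_sSup_iff_of_directedOn {x : L} : x ∈ sSup c ↔ ∃ R ∈ c, x ∈ R := by
  have := hne.to_subtype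
  rw [sSup_eq_iSup', ← SetLike.mem_coe, coe_iSup_of_directed hdir.directed_val]
  simp

theorem exists_isSumSq_coe_eq_of_isSumSq_sSup {s : (sSup c : IntermediateField F L)}
    (hs : IsSumSq s) : ∃ R ∈ c, ∃ t : R, IsSumSq t ∧ (t : L) = s := by
  induction hs with
  | zero =>
    obtain ⟨R, hR⟩ := hne
    exact ⟨R, hR, 0, IsSumSq.zero, rfl⟩
  | @sq_add b s _ ih =>
    obtain ⟨R₁, hR₁, t, ht, hts⟩ := ih
    obtain ⟨R₂, hR₂, hb⟩ := (mem_sSup_iff_of_directedOn hne hdir).1 b.2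
    obtain ⟨R, hR, h₁, h₂⟩ := hdir R₁ hR₁ R₂ hR₂
    refine ⟨R, hR, ⟨b, h₂ hb⟩ * ⟨b, h₂ hb⟩ + inclusion h₁ t,
      IsSumSq.sq_add _ (isSumSq_map (inclusion h₁).toRingHom ht), ?_⟩
    rw [AddMemClass.coe_add, AddMemClass.coe_add, coe_inclusion, hts]
    rfl

theorem isFormallyReal_sSup (hc : ∀ R ∈ c, IsFormallyReal R) :
    IsFormallyReal (sSup c : IntermediateField F L) := by
  refine isFormallyReal_iff_not_isSumSq_neg_one.2 fun h => ?_
  obtain ⟨R, hR, t, ht, hts⟩ := exists_isSumSq_coe_eq_of_isSumSq_sSup hne hdir h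
  have ht1 : t = -1 := Subtype.ext hts
  exact isFormallyReal_iff_not_isSumSq_neg_one.1 (hc R hR) (ht1 ▸ ht)

end Directed

theorem exists_maximal_isFormallyReal (F L : Type*) [Field F] [Field L] [Algebra F L]
    [IsFormallyReal F] : ∃ R : IntermediateField F L,
      Maximal (fun R : IntermediateField F L => IsFormallyReal R) R := by
  have hbot : IsFormallyReal (⊥ : IntermediateField F L) :=
    isFormallyReal_iff_not_isSumSq_neg_one.2 fun h =>
      isFormallyReal_iff_not_isSumSq_neg_one.1 ‹IsFormallyReal F› <| by
        simpa using isSumSq_map (botEquiv F L).toRingEquiv.toRingHom h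
  obtain ⟨R, -, hR⟩ := zorn_le_nonempty₀ {R : IntermediateField F L | IsFormallyReal R}
    (fun c hc hchain R hR => ⟨sSup c, isFormallyReal_sSup ⟨R, hR⟩ hchain.directedOn hc,
      fun _ => le_sSup⟩) ⊥ hbot
  exact ⟨R, hR⟩

theorem mem_or_mul_mem_of_maximal {R : IntermediateField F L}
    (hR : Maximal (fun R : IntermediateField F L => IsFormallyReal R) R) {i x : L}
    (hi : i ^ 2 = -1) (hx : x ^ 2 ∈ R) : x ∈ R ∨ i * x ∈ R := by
  -- Otherwise `R(x)` and `R(ix)` are not formally real, so `-x ^ 2` and `x ^ 2` are sums of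
  -- squares.
  have : IsFormallyReal R := hR.prop
  have hneg : ∀ (y : L) (a : R), y ^ 2 = algebraMap R L a → y ∉ R → IsSumSq (-a) := by
    intro y a hy hyR
    refine isSumSq_neg_of_not_isFormallyReal_adjoin hy (by rintro ⟨c, rfl⟩; exact hyR c.2)
      fun h => hyR ?_
    exact hR.le_of_ge (y := R⟮y⟯.restrictScalars F) h (fun z hz => R⟮y⟯.algebraMap_mem ⟨z, hz⟩)
      (mem_adjoin_simple_self R y)
  by_contra! hcon
  have hx_neg := hneg x ⟨x ^ 2, hx⟩ rfl hcon.1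
  have hx_pos := hneg (i * x) (-⟨x ^ 2, hx⟩)
    (by rw [mul_pow, hi, map_neg, neg_one_mul]; rfl) hcon.2
  have hx0 : x ^ 2 = 0 :=
    congrArg Subtype.val
      (neg_eq_zero.1 (IsFormallyReal.eq_zero_of_isSumSq_of_neg_isSumSq hx_neg hx_pos))
  exact hcon.1 (eq_zero_of_pow_eq_zero hx0 ▸ zero_mem R)

end FormallyReal

section PGroup

variable {p : ℕ}

theorem exists_normal_index_eq_of_isPGroup {G : Type*} [Group G] [Finite G] [Nontrivial G]
    (hp : p.Prime) (hG : IsPGroup p G) : ∃ H : Subgroup G, H.Normal ∧ H.index = p := by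
  have := Fact.mk hp
  obtain ⟨n, hn⟩ := hG.exists_card_eq
  obtain ⟨m, rfl⟩ := Nat.exists_eq_succ_of_ne_zero (n := n) <| by
    rintro rfl
    exact Finite.one_lt_card.ne' hn
  obtain ⟨H, hH⟩ := Sylow.exists_subgroup_card_pow_prime p (hn ▸ pow_dvd_pow p m.le_succ)
  have hindex : H.index = p := by
    have h := H.card_mul_index
    rw [hH, hn, pow_succ] at h
    exact Nat.eq_of_mul_eq_mul_left (pow_pos hp.pos m) h
  refine ⟨H, Subgroup.normal_of_index_eq_minFac_card ?_, hindex⟩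
  rw [hindex, hn, hp.pow_minFac m.succ_ne_zero]

variable {F L : Type*} [Field F] [Field L] [Algebra F L] [IsGalois F L]

theorem exists_isCyclicExt_of_isPGroup [FiniteDimensional F L] [Nontrivial Gal(L/F)]
    (hp : p.Prime) (hpg : IsPGroup p Gal(L/F)) :
    ∃ K : IntermediateField F L, IsCyclicExt p F K := by
  have := Fact.mk hp
  obtain ⟨H, hH, hindex⟩ := exists_normal_index_eq_of_isPGroup hp hpg
  have hgal : IsGalois F (fixedField H) := inferInstance
  have hfin : Module.finrank F (fixedField H) = p := by
    rw [finrank_eq_fixingSubgroup_index, fixingSubgroup_fixedField, hindex]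
  exact ⟨fixedField H, hgal,
    isCyclic_of_prime_card (by rw [IsGalois.card_aut_eq_finrank, hfin]), hfin⟩

theorem exists_pow_mem_of_isPGroup {ξ : F} (hp : p.Prime) (hξ : IsPrimitiveRoot ξ p)
    (hpg : IsPGroup p Gal(L/F)) {z : L} (hz : z ∉ (algebraMap F L).range) :
    ∃ y : L, y ∉ (algebraMap F L).range ∧ y ^ p ∈ (algebraMap F L).range := by
  let M : IntermediateField F L := normalClosure F F⟮z⟯ L
  have hzM : z ∈ M := le_normalClosure F⟮z⟯ (mem_adjoin_simple_self F z)
  have : FiniteDimensional F F⟮z⟯ := adjoin.finiteDimensional (Algebra.IsIntegral.isIntegral z)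
  have : FiniteDimensional F M := normalClosure.is_finiteDimensional F F⟮z⟯ L
  have : IsGalois F M := IsGalois.normalClosure F F⟮z⟯ L
  have : Nontrivial Gal(M/F) := not_subsingleton_iff_nontrivial.1 fun _ => by
    have hM : M = ⊥ := IntermediateField.finrank_eq_one_iff.1 <| by
      rw [← IsGalois.card_aut_eq_finrank, Nat.card_unique]
    exact hz (mem_bot.1 (hM ▸ hzM))
  obtain ⟨K, hK⟩ := exists_isCyclicExt_of_isPGroup hp
    (hpg.of_surjective _ (AlgEquiv.restrictNormalHom_surjective (F := F) (K₁ := M) L))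
  obtain ⟨a, θ, hθ, hKθ⟩ := hK.exists_eq_adjoin_simple hp hξ
  refine ⟨θ, fun ⟨b, hb⟩ => ?_, a, (congrArg Subtype.val hθ).symm⟩
  have hbot : K = ⊥ := by
    rw [hKθ, adjoin_simple_eq_bot_iff]
    exact ⟨b, Subtype.ext hb⟩
  exact hp.ne_one (by rw [← hK.finrank_eq, hbot, IntermediateField.finrank_bot])

end PGroup

section Involution

variable {R L : Type*} [Field R] [Field L] [Algebra R L] {i : L}

theorem sq_eq_one_of_adjoin_eq_top (hi : i ^ 2 = -1) {c : Gal(L/R)} (hc : c i = -i)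
    (htop : R⟮i⟯ = ⊤) : c ^ 2 = 1 := by
  refine AlgEquiv.ext fun z => ?_
  obtain ⟨s, t, rfl⟩ := exists_eq_add_mul_of_mem_adjoin_sqrt (a := -1)
    (by rw [hi, map_neg, map_one]) (htop ▸ mem_top : z ∈ R⟮i⟯)
  simp [sq, hc]

variable [IsFormallyReal R]

theorem notMem_range_of_sq_eq_neg_one (hi : i ^ 2 = -1) : i ∉ (algebraMap R L).range := by
  rintro ⟨b, rfl⟩
  have hb : b * b = -1 := (algebraMap R L).injective
    (by rw [map_mul, ← sq, hi, map_neg, map_one])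
  exact isFormallyReal_iff_not_isSumSq_neg_one.1 ‹_› (hb ▸ IsSumSq.mul_self b)

theorem exists_apply_eq_neg_of_sq_eq_neg_one [IsGalois R L] (hi : i ^ 2 = -1) :
    ∃ c : Gal(L/R), c i = -i := by
  by_contra! hcon
  refine notMem_range_of_sq_eq_neg_one (R := R) hi
    ((InfiniteGalois.mem_range_algebraMap_iff_fixed i).2 fun g => ?_)
  exact (apply_eq_or_eq_neg_of_sq_eq g (a := -1)
    (by rw [hi, map_neg, map_one])).resolve_right (hcon g)

section QuadraticallyClosed

variable (hi : i ^ 2 = -1) (hsq : ∀ x : L, x ^ 2 ∈ (algebraMap R L).range →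
  x ∈ (algebraMap R L).range ∨ i * x ∈ (algebraMap R L).range) {c : Gal(L/R)} (hc : c i = -i)
include hi hsq hc

theorem mul_apply_mem_range_of_sq_mem_adjoin {y : L} (hy : y ^ 2 ∈ R⟮i⟯) :
    y * c y ∈ (algebraMap R L).range := by
  -- If `y ^ 2 = s + t * i`, then `(y * c y) ^ 2 = s ^ 2 + t ^ 2`, and `-(s ^ 2 + t ^ 2)` is a
  -- square in `R` only if it vanishes.
  obtain ⟨s, t, hst⟩ := exists_eq_add_mul_of_mem_adjoin_sqrt (a := -1)
    (by rw [hi, map_neg, map_one]) hy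
  have hnorm : (y * c y) ^ 2 = algebraMap R L (s * s + t * t) := by
    rw [mul_pow, ← map_pow, hst]
    simp only [map_add, map_mul, AlgEquiv.commutes, hc]
    linear_combination -algebraMap R L t ^ 2 * hi
  rcases hsq _ ⟨_, hnorm.symm⟩ with h | ⟨r, hr⟩
  · exact h
  · have hsum : r * r + (s * s + t * t) = 0 := by
      refine (algebraMap R L).injective ?_
      rw [map_add, ← hnorm, map_mul, hr, map_zero]
      linear_combination (y * c y) ^ 2 * hi
    have hr0 : r * r = 0 := IsFormallyReal.eq_zero_of_add_right (IsSumSq.mul_self r)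
      ((IsSumSq.mul_self s).add (IsSumSq.mul_self t)) hsum
    rw [mul_self_eq_zero.1 hr0, map_zero] at hr
    exact ⟨0, by rw [map_zero]; linear_combination -i * hr - y * c y * hi⟩

theorem mem_adjoin_of_sq_mem_adjoin {y : L} (hy : y ^ 2 ∈ R⟮i⟯) : y ∈ R⟮i⟯ := by
  have hmem : ∀ x : L, x ^ 2 ∈ (algebraMap R L).range → x ∈ R⟮i⟯ := by
    intro x hx
    rcases hsq x hx with ⟨b, rfl⟩ | ⟨b, hb⟩
    · exact R⟮i⟯.algebraMap_mem b
    · have hxb : x = -(i * algebraMap R L b) := by linear_combination x * hi + i * hb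
      rw [hxb]
      exact neg_mem (mul_mem (mem_adjoin_simple_self R i) (R⟮i⟯.algebraMap_mem b))
  obtain ⟨n, hn⟩ := mul_apply_mem_range_of_sq_mem_adjoin hi hsq hc hy
  obtain ⟨s, t, hst⟩ := exists_eq_add_mul_of_mem_adjoin_sqrt (a := -1)
    (by rw [hi, map_neg, map_one]) hy
  have htrace : y ^ 2 + c y ^ 2 = algebraMap R L (2 * s) := by
    rw [← map_pow, hst]
    simp only [map_add, map_mul, map_ofNat, AlgEquiv.commutes, hc]
    ring
  have hadd : y + c y ∈ R⟮i⟯ := hmem _ ⟨2 * s + 2 * n, by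
    simp only [map_add, map_mul, map_ofNat] at htrace ⊢
    linear_combination 2 * hn - htrace⟩
  have hsub : y - c y ∈ R⟮i⟯ := hmem _ ⟨2 * s - 2 * n, by
    simp only [map_sub, map_mul, map_ofNat] at htrace ⊢
    linear_combination -2 * hn - htrace⟩
  have : CharZero L := charZero_of_injective_algebraMap (algebraMap R L).injective
  have hhalf : y = ((y + c y) + (y - c y)) / 2 := by ring
  rw [hhalf]
  exact div_mem (add_mem hadd hsub) (ofNat_mem _ 2)

theorem adjoin_eq_top_of_isPGroup [IsGalois R L] (hpg : IsPGroup 2 Gal(L/R)) : R⟮i⟯ = ⊤ := by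
  rw [eq_top_iff]
  by_contra h
  obtain ⟨z, -, hz⟩ := SetLike.not_le_iff_exists.1 h
  have hξ : IsPrimitiveRoot (-1 : R) 2 := IsPrimitiveRoot.neg_one 0 two_ne_zero.symm
  obtain ⟨y, hy, b, hb⟩ := exists_pow_mem_of_isPGroup Nat.prime_two
    (hξ.map_of_injective (algebraMap R R⟮i⟯).injective)
    (hpg.of_injective _ (AlgEquiv.restrictScalarsHom_injective R)) (z := z)
    (by rintro ⟨w, rfl⟩; exact hz w.2)
  exact hy ⟨⟨y, mem_adjoin_of_sq_mem_adjoin hi hsq hc (hb ▸ b.2)⟩, rfl⟩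

end QuadraticallyClosed

variable {F : Type*} [Field F] [Algebra F L] [IsGalois F L]

theorem exists_involution_of_isFormallyReal [IsFormallyReal F] (hpg : IsPGroup 2 Gal(L/F))
    (hi : i ^ 2 = -1) : ∃ σ : Gal(L/F), σ ^ 2 = 1 ∧ σ i = -i := by
  obtain ⟨R, hR⟩ := exists_maximal_isFormallyReal F L
  have : IsFormallyReal R := hR.prop
  obtain ⟨c, hc⟩ := exists_apply_eq_neg_of_sq_eq_neg_one (R := R) hi
  have hsq : ∀ x : L, x ^ 2 ∈ (algebraMap R L).range →
      x ∈ (algebraMap R L).range ∨ i * x ∈ (algebraMap R L).range := by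
    rintro x ⟨a, ha⟩
    exact (mem_or_mul_mem_of_maximal hR hi (ha ▸ a.2)).imp (fun h => ⟨⟨x, h⟩, rfl⟩)
      fun h => ⟨⟨i * x, h⟩, rfl⟩
  have hpgR : IsPGroup 2 Gal(L/R) :=
    hpg.of_injective _ (AlgEquiv.restrictScalarsHom_injective F)
  have htop := adjoin_eq_top_of_isPGroup hi hsq hc hpgR
  exact ⟨AlgEquiv.restrictScalarsHom F c,
    by rw [← map_pow, sq_eq_one_of_adjoin_eq_top hi hc htop, map_one], hc⟩

theorem exists_notMem_Phi_orderOf_eq_two [IsFormallyReal F] (hpg : IsPGroup 2 Gal(L/F))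
    (hi : i ^ 2 = -1) : ∃ σ : Gal(L/F), σ ∉ Phi 2 Gal(L/F) ∧ orderOf σ = 2 := by
  obtain ⟨σ, hσ, hσi⟩ := exists_involution_of_isFormallyReal hpg hi
  have : CharZero L := charZero_of_injective_algebraMap (algebraMap F L).injective
  have hi0 : i ≠ 0 := by
    rintro rfl
    norm_num at hi
  have hne : σ i ≠ i := by rwa [hσi, Ne, neg_eq_self]
  have hξ : IsPrimitiveRoot (-1 : F) 2 := IsPrimitiveRoot.neg_one 0 two_ne_zero.symm
  refine ⟨σ, (notMem_Phi_iff Nat.prime_two hξ).2 ⟨-1, i, by rw [hi, map_neg, map_one], hne⟩, ?_⟩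
  have := Fact.mk Nat.prime_two
  exact orderOf_eq_prime hσ fun h => hne (by rw [h, AlgEquiv.one_apply])

end Involution

section TwoStep

variable {F Ω : Type*} [Field F] [Field Ω] [Algebra F Ω] [IsGalois F Ω] {p : ℕ}

theorem pow_apply_eq_of_mem_secondSecond (hp : p.Prime) (τ : Gal(Ω/F)) {x : Ω}
    (hx : x ∈ secondSecond p F Ω) : (τ ^ p ^ 2) x = x := by
  have hτ : τ ^ p ∈ (maxElem p F Ω).fixingSubgroup :=
    (IntermediateField.mem_fixingSubgroup_iff _ _).2 fun y hy => ((mem_maxElem_iff hp y).1 hy τ 1).1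
  let g : Gal(Ω/maxElem p F Ω) := fixingSubgroupEquiv _ ⟨τ ^ p, hτ⟩
  have hg : AlgEquiv.restrictScalarsHom F (g ^ p) = τ ^ p ^ 2 := by
    rw [map_pow, sq, pow_mul]
    rfl
  rw [← hg]
  exact ((mem_maxElem_iff hp x).1 hx g 1).1

theorem isPGroup_of_le_secondSecond (hp : p.Prime) {K : IntermediateField F Ω} [Normal F K]
    (hK : K ≤ secondSecond p F Ω) : IsPGroup p Gal(K/F) := by
  intro σ
  obtain ⟨τ, rfl⟩ := AlgEquiv.restrictNormalHom_surjective (F := F) (K₁ := K) Ω σ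
  refine ⟨2, ?_⟩
  rw [← map_pow, ← MonoidHom.mem_ker, restrictNormalHom_ker,
    IntermediateField.mem_fixingSubgroup_iff]
  exact fun x hx => pow_apply_eq_of_mem_secondSecond hp τ (hK hx)

theorem exists_notMem_Phi_orderOf_eq_two_of_maxElem_le [IsFormallyReal F]
    (hΩ : ∀ y : Ω, ∃ x : Ω, x ^ 2 = y) {K : IntermediateField F Ω} [Normal F K]
    (hle : maxElem 2 F Ω ≤ K) (hK : K ≤ secondSecond 2 F Ω) :
    ∃ σ : Gal(K/F), σ ∉ Phi 2 Gal(K/F) ∧ orderOf σ = 2 := by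
  have : IsGalois F K := ⟨⟩
  have hξ : IsPrimitiveRoot (-1 : F) 2 := IsPrimitiveRoot.neg_one 0 two_ne_zero.symm
  obtain ⟨i, hi⟩ := hΩ (-1)
  have hiK : i ∈ K := hle (mem_maxElem_of_pow_eq (a := -1) Nat.prime_two hξ
    (by rw [hi, map_neg, map_one]))
  exact exists_notMem_Phi_orderOf_eq_two (isPGroup_of_le_secondSecond Nat.prime_two hK)
    (i := ⟨i, hiK⟩) (Subtype.ext hi)

end TwoStep

end SmallGalois

open SmallGalois in
theorem mainTheorem5_general (p : ℕ) (hp : p.Prime) (F Ω : Type*) [Field F] [Field Ω] [Algebra F Ω]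
    [IsGalois F Ω] (hΩ : ∀ y : Ω, ∃ x : Ω, x ^ p = y) (ξ : F) (hξ : IsPrimitiveRoot ξ p) :
    List.TFAE
      [∃ σ : VGroup p F Ω,
          σ ∉ Phi p (VGroup p F Ω) ∧ orderOf σ = p,
        ∃ σ : WGroup p F Ω,
          σ ∉ Phi p (WGroup p F Ω) ∧ orderOf σ = p,
        ∃ σ : VGroup p F Ω,
          σ ∉ Phi p (VGroup p F Ω) ∧
          ∀ (E : IntermediateField F Ω) (hE : IsCyclicExt p F E),
            IsOfFinOrder (toT hp E hE σ) ∧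
              orderOf (toT hp E hE σ) ≤ p,
        p = 2 ∧ IsFormallyReal F] ∧
    (∀ σ : VGroup p F Ω,
        σ ∉ Phi p (VGroup p F Ω) → orderOf σ = p →
        IsOrderingSet (fixedRoots σ)) ∧
    (∀ σ : WGroup p F Ω,
        σ ∉ Phi p (WGroup p F Ω) → orderOf σ = p →
        IsOrderingSet (fixedRoots σ)) ∧
    (∀ σ : VGroup p F Ω,
        σ ∉ Phi p (VGroup p F Ω) →
        (∀ (E : IntermediateField F Ω) (hE : IsCyclicExt p F E),
            IsOfFinOrder (toT hp E hE σ) ∧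
              orderOf (toT hp E hE σ) ≤ p) →
        IsOrderingSet (fixedRoots σ)) := by
  have hsecond : ∀ σ : VGroup p F Ω, orderOf σ = p →
      ∀ (E : IntermediateField F Ω) (hE : IsCyclicExt p F E),
        IsOfFinOrder (toT hp E hE σ) ∧ orderOf (toT hp E hE σ) ≤ p := fun σ hord E hE =>
    ⟨(toT hp E hE).isOfFinOrder (orderOf_pos_iff.1 (hp.pos.trans_eq hord.symm)),
      Nat.le_of_dvd hp.pos ((orderOf_map_dvd (toT hp E hE) σ).trans hord.dvd)⟩
  refine ⟨?_, fun σ hσ hord => (eq_two_and_isOrderingSet_of_toT hp hξ hΩ hσ (hsecond σ hord)).2,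
    fun σ hσ hord => (eq_two_and_isOrderingSet_of_third hp hξ hΩ hσ hord).2,
    fun σ hσ hT => (eq_two_and_isOrderingSet_of_toT hp hξ hΩ hσ hT).2⟩
  tfae_have 1 → 3 := fun ⟨σ, hσ, hord⟩ => ⟨σ, hσ, hsecond σ hord⟩
  tfae_have 3 → 4 := fun ⟨σ, hσ, hT⟩ =>
    (eq_two_and_isOrderingSet_of_toT hp hξ hΩ hσ hT).imp_right IsOrderingSet.isFormallyReal
  tfae_have 2 → 4 := fun ⟨σ, hσ, hord⟩ =>
    (eq_two_and_isOrderingSet_of_third hp hξ hΩ hσ hord).imp_right IsOrderingSet.isFormallyReal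
  tfae_have 4 → 1 := by
    rintro ⟨rfl, _⟩
    have := isGalois_secondSecond (F := F) (Ω := Ω) hp
    exact exists_notMem_Phi_orderOf_eq_two_of_maxElem_le hΩ maxElem_le_secondSecond le_rfl
  tfae_have 4 → 2 := by
    rintro ⟨rfl, _⟩
    exact exists_notMem_Phi_orderOf_eq_two_of_maxElem_le hΩ maxElem_le_third
      third_le_secondSecond
  tfae_finish

theorem mainTheorem5 (p : ℕ) (hp : p.Prime) (F Ω : Type*) [Field F] [Field Ω] [Algebra F Ω]
    [IsSepClosure F Ω] (ξ : F) (hξ : IsPrimitiveRoot ξ p) :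
    List.TFAE
      [∃ σ : SmallGalois.VGroup p F Ω,
          σ ∉ SmallGalois.Phi p (SmallGalois.VGroup p F Ω) ∧ orderOf σ = p,
        ∃ σ : SmallGalois.WGroup p F Ω,
          σ ∉ SmallGalois.Phi p (SmallGalois.WGroup p F Ω) ∧ orderOf σ = p,
        ∃ σ : SmallGalois.VGroup p F Ω,
          σ ∉ SmallGalois.Phi p (SmallGalois.VGroup p F Ω) ∧
          ∀ (E : IntermediateField F Ω) (hE : SmallGalois.IsCyclicExt p F E),
            IsOfFinOrder (SmallGalois.toT hp E hE σ) ∧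
              orderOf (SmallGalois.toT hp E hE σ) ≤ p,
        p = 2 ∧ IsFormallyReal F] ∧
    (∀ σ : SmallGalois.VGroup p F Ω,
        σ ∉ SmallGalois.Phi p (SmallGalois.VGroup p F Ω) → orderOf σ = p →
        SmallGalois.IsOrderingSet (SmallGalois.fixedRoots σ)) ∧
    (∀ σ : SmallGalois.WGroup p F Ω,
        σ ∉ SmallGalois.Phi p (SmallGalois.WGroup p F Ω) → orderOf σ = p →
        SmallGalois.IsOrderingSet (SmallGalois.fixedRoots σ)) ∧
    (∀ σ : SmallGalois.VGroup p F Ω,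
        σ ∉ SmallGalois.Phi p (SmallGalois.VGroup p F Ω) →
        (∀ (E : IntermediateField F Ω) (hE : SmallGalois.IsCyclicExt p F E),
            IsOfFinOrder (SmallGalois.toT hp E hE σ) ∧
              orderOf (SmallGalois.toT hp E hE σ) ≤ p) →
        SmallGalois.IsOrderingSet (SmallGalois.fixedRoots σ)) := by
  have : IsSepClosed Ω := IsSepClosure.sep_closed F
  have hΩ := SmallGalois.exists_pow_eq_of_isSepClosed hp.ne_zero
    (hξ.map_of_injective (algebraMap F Ω).injective)
  exact mainTheorem5_general p hp F Ω hΩ ξ hξ
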